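/- Let $0<\alpha<1$, $0<\beta\le 2$, $d\in\mathbb N$, $a<t$ and $x\in\mathbb R^d$. On a probability space let $X=\{X_s\}_{s\ge 0}$ be an isotropic $\beta$-stable process in $\mathbb R^d$ started at $0$: a Lévy process with almost surely càdlàg paths such that, for some finite measure $\lambda$ on the unit sphere $S$ and some $\gamma\in\mathbb R^d$, $$\mathbb E\big[e^{i\langle z,X_1\rangle}\big]=\exp\Big[-\int_S \kappa_\beta(\langle z,\xi\rangle)\,\lambda(d\xi)+i\langle\gamma,z\rangle\Big]\qquad(z\in\mathbb R^d),$$ where $\kappa_\beta(y)=|y|^\beta\big(1-i\tan\tfrac{\pi\beta}{2}\,\mathrm{sgn}\,y\big)$ if $\beta\ne1$ and $\kappa_1(y)=|y|\big(1+\tfrac{2i}{\pi}\,\mathrm{sgn}(y)\log|y|\big)$ (with $\kappa_1(0)=0$), and such that the coordinates of $X_1$ are identically distributed ("isotropic"). Let $\tau=\{\tau_s\}_{s\ge0}$ be an $\alpha$-stable subordinator, i.e. a Lévy process in $\mathbb R$ with almost surely nondecreasing càdlàg paths and $$\mathbb E\big[e^{iz\tau_1}\big]=\exp\Big[\int_0^\infty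 (e^{izy}-1)\frac{\alpha}{\Gamma(1-\alpha)}y^{-\alpha-1}\,dy\Big]\qquad(z\in\mathbb R),$$ and assume that the processes $X$ and $\tau$ are independent. Put $X^x_s:=x+X_s$ and $T_t:=\inf\{s>0:\ t-\tau_s<a\}$. Then $$\mathbb P\big[|X^x_{T_t}|>u\big]=O(u^{-\beta})\qquad\text{as }u\to\infty,$$ where $|\cdot|$ is the Euclidean norm. -/

import Mathlib

open MeasureTheory ProbabilityTheory Filter Topology Asymptotics
open scoped NNReal

namespace StableTimeChange

/-- A Lévy process on `(Ω, P)`: it starts at `0`, has independent and stationary increments, and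
almost surely has càdlàg paths. -/
structure IsLevyProcess {Ω E : Type*} [MeasurableSpace Ω] [NormedAddCommGroup E]
    [MeasurableSpace E] (X : ℝ≥0 → Ω → E) (P : Measure Ω) : Prop where
  measurable : ∀ s, Measurable (X s)
  zero : ∀ᵐ ω ∂P, X 0 ω = 0
  indepIncrements : HasIndepIncrements X P
  stationaryIncrements : ∀ s h, IdentDistrib (fun ω => X (s + h) ω - X s ω) (X h) P P
  cadlag : ∀ᵐ ω ∂P, ∀ s, ContinuousWithinAt (fun r => X r ω) (Set.Ici s) s ∧
    ∃ l, Tendsto (fun r => X r ω) (𝓝[<] s) (𝓝 l)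

/-- The integrand of the exponent of a `β`-stable characteristic function, as a function of
`y = ⟨z, ξ⟩`: it is `|y|^β (1 - i tan(πβ/2) sgn y)` if `β ≠ 1`, and
`|y| (1 + i (2/π) sgn y log |y|)` if `β = 1`. -/
noncomputable def stableKernel (β y : ℝ) : ℂ :=
  if β = 1 then
    ((|y| : ℝ) : ℂ) * (1 + Complex.I * ((2 / Real.pi * Real.sign y * Real.log |y| : ℝ) : ℂ))
  else
    ((|y| ^ β : ℝ) : ℂ) * (1 - Complex.I * ((Real.tan (Real.pi * β / 2) * Real.sign y : ℝ) : ℂ))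

/-- `μ` is a `β`-stable law on `ℝ^d`: its characteristic function is
`z ↦ exp (-∫ stableKernel β ⟨z, ξ⟩ Λ(dξ) + i ⟨γ, z⟩)` for some finite measure `Λ` on the unit
sphere and some vector `γ`. -/
def IsStableLaw {d : ℕ} (β : ℝ) (μ : Measure (EuclideanSpace ℝ (Fin d))) : Prop :=
  ∃ (Λ : Measure (Metric.sphere (0 : EuclideanSpace ℝ (Fin d)) 1))
    (γ : EuclideanSpace ℝ (Fin d)), IsFiniteMeasure Λ ∧
    ∀ z, charFun μ z = Complex.exp
      (-(∫ ξ, stableKernel β (inner ℝ z (ξ : EuclideanSpace ℝ (Fin d))) ∂Λ)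
        + Complex.I * ((inner ℝ γ z : ℝ) : ℂ))

/-- An isotropic `β`-stable process started at `0`: a Lévy process whose value at time `1` has a
`β`-stable law with identically distributed coordinates. -/
structure IsIsotropicStableProcess {Ω : Type*} [MeasurableSpace Ω] {d : ℕ} (β : ℝ)
    (X : ℝ≥0 → Ω → EuclideanSpace ℝ (Fin d)) (P : Measure Ω) : Prop where
  isLevyProcess : IsLevyProcess X P
  isStableLaw : IsStableLaw β (P.map (X 1))
  isotropic : ∀ i j : Fin d, IdentDistrib (fun ω => X 1 ω i) (fun ω => X 1 ω j) P P

/-- The `α`-stable subordinator: a Lévy process with almost surely nondecreasing real paths and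
`E[exp (i z τ₁)] = exp (∫₀^∞ (exp (i z x) - 1) α / Γ(1 - α) x^(-α-1) dx)`. -/
structure IsStableSubordinator {Ω : Type*} [MeasurableSpace Ω] (α : ℝ)
    (τ : ℝ≥0 → Ω → ℝ) (P : Measure Ω) : Prop where
  isLevyProcess : IsLevyProcess τ P
  monotone : ∀ᵐ ω ∂P, Monotone (fun s => τ s ω)
  charFun_one : ∀ z : ℝ, charFun (P.map (τ 1)) z = Complex.exp
    (∫ x in Set.Ioi (0 : ℝ), (Complex.exp (Complex.I * (z : ℂ) * (x : ℂ)) - 1) *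
      ((α / Real.Gamma (1 - α) * x ^ (-α - 1) : ℝ) : ℂ))

/-- The inverse subordinator `T_t = inf {s > 0 : t - τ_s < a}`. -/
noncomputable def inverseTime {Ω : Type*} (τ : ℝ≥0 → Ω → ℝ) (a t : ℝ) (ω : Ω) : ℝ≥0 :=
  sInf {s : ℝ≥0 | 0 < s ∧ t - τ s ω < a}

end StableTimeChange

namespace StableTimeChange

/-! An independent random time with exponential tails cannot make the tail heavier than that of `X
1`. Write `T` for the inverse time and `n = ⌊T⌋`. For `n ≥ 1` this forces `τ (n - 1) ≤ t - a`, which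
by Chernoff's bound has probability at most `e^(t - a) ρ^(n - 1)`, where `ρ = E e^(-τ 1) < 1`. If
moreover `|X T| > w`, then one of the `n + 1` unit blocks covering `[0, n + 1]` has an increment
from its left end larger than `w / (n + 1)`. By stationarity and Ottaviani's inequality each block
does so with probability `O((w / (n + 1))^(-β))`. Independence multiplies the two bounds, and `∑
ρ^(n - 1) (n + 1)^(1 + β)` converges; this is `exists_measureReal_inverseTime_le`.

The tail of `X 1` itself comes from `1 - Re φ(z) = O(|z|^β)` at the origin
(`IsStableLaw.one_sub_re_charFun_le`) through the truncation inequality.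

Suprema run over dyadic times only, so the events are countable unions; right-continuity of the
paths brings in the time `T`, whose measurability is not needed. -/

/-! ### The characteristic function of a stable law near the origin -/

lemma stableKernel_re (β y : ℝ) : (stableKernel β y).re = |y| ^ β := by
  unfold stableKernel
  split_ifs with h
  · subst h; simp
  · rw [Complex.re_ofReal_mul, Complex.sub_re, mul_comm Complex.I, Complex.re_ofReal_mul]; simp

/-- The exponent `β / 2` suffices because the imaginary part is later squared. The room it leaves
absorbs the logarithm at `β = 1`: there `|y|` splits into two square roots, one of which tames `log
|y|`. -/
lemma exists_abs_stableKernel_im_le (β : ℝ) (hβ : 0 < β) :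
    ∃ K, 0 ≤ K ∧ ∀ y : ℝ, |y| ≤ 1 → |(stableKernel β y).im| ≤ K * |y| ^ (β / 2) := by
  have hs : ∀ y : ℝ, |Real.sign y| ≤ 1 := fun y => by
    rcases Real.sign_apply_eq y with h | h | h <;> simp [h]
  by_cases h : β = 1
  · subst h
    refine ⟨2 / Real.pi * 2, by positivity, fun y hy => ?_⟩
    rcases eq_or_ne y 0 with rfl | h0
    · simp [stableKernel]
    have hpos : 0 < |y| := abs_pos.2 h0
    have hlog := (Real.abs_log_mul_self_rpow_lt |y| (1 / 2) hpos hy (by norm_num)).le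
    have him : (stableKernel 1 y).im
        = 2 / Real.pi * Real.sign y * ((Real.log |y| * |y| ^ (1 / 2 : ℝ)) * |y| ^ (1 / 2 : ℝ)) := by
      rw [mul_assoc (Real.log |y|), ← Real.rpow_add hpos]
      norm_num [stableKernel]
      ring
    rw [him, abs_mul, abs_mul, abs_mul (Real.log |y| * _), abs_of_pos (by positivity : 0 < 2 / Real.pi),
      abs_of_pos (Real.rpow_pos_of_pos hpos (1 / 2))]
    have h2 : |Real.log |y| * |y| ^ (1 / 2 : ℝ)| ≤ 2 := by norm_num at hlog ⊢; exact hlog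
    calc 2 / Real.pi * |Real.sign y| * (|Real.log |y| * |y| ^ (1 / 2 : ℝ)| * |y| ^ (1 / 2 : ℝ))
        ≤ 2 / Real.pi * 1 * (2 * |y| ^ (1 / 2 : ℝ)) := by
          gcongr
          exact hs y
      _ = _ := by ring
  · refine ⟨|Real.tan (Real.pi * β / 2)|, abs_nonneg _, fun y hy => ?_⟩
    have him : (stableKernel β y).im = -(|y| ^ β * (Real.tan (Real.pi * β / 2) * Real.sign y)) := by
      simp only [stableKernel, if_neg h]
      rw [Complex.im_ofReal_mul, Complex.sub_im, mul_comm Complex.I, Complex.im_ofReal_mul]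
      simp
    rw [him, abs_neg, abs_mul, abs_mul, abs_of_nonneg (Real.rpow_nonneg (abs_nonneg y) β)]
    have h3 : |y| ^ β ≤ |y| ^ (β / 2) := by
      rcases (abs_nonneg y).eq_or_lt with h0 | h0
      · rw [← h0, Real.zero_rpow hβ.ne', Real.zero_rpow (by positivity)]
      · exact Real.rpow_le_rpow_of_exponent_ge h0 hy (by linarith)
    calc |y| ^ β * (|Real.tan (Real.pi * β / 2)| * |Real.sign y|)
        ≤ |y| ^ (β / 2) * (|Real.tan (Real.pi * β / 2)| * 1) := by
          gcongr
          exact hs y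
      _ = _ := by ring

/-- Integrability need not be assumed: otherwise the integral is `0` by convention. -/
lemma abs_re_integral_le {S : Type*} [MeasurableSpace S] (Λ : Measure S) [IsFiniteMeasure Λ]
    {f : S → ℂ} {A : ℝ} (hA : 0 ≤ A) (h : ∀ x, |(f x).re| ≤ A) :
    |(∫ x, f x ∂Λ).re| ≤ A * Λ.real Set.univ := by
  by_cases hf : Integrable f Λ
  · have := integral_re hf
    simp only [RCLike.re_eq_complex_re] at this
    rw [← this, ← Real.norm_eq_abs]
    exact norm_integral_le_of_norm_le_const (ae_of_all _ h)
  · rw [integral_undef hf]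
    simp only [Complex.zero_re, abs_zero]
    positivity

lemma abs_im_integral_le {S : Type*} [MeasurableSpace S] (Λ : Measure S) [IsFiniteMeasure Λ]
    {f : S → ℂ} {A : ℝ} (hA : 0 ≤ A) (h : ∀ x, |(f x).im| ≤ A) :
    |(∫ x, f x ∂Λ).im| ≤ A * Λ.real Set.univ := by
  by_cases hf : Integrable f Λ
  · have := integral_im hf
    simp only [RCLike.im_eq_complex_im] at this
    rw [← this, ← Real.norm_eq_abs]
    exact norm_integral_le_of_norm_le_const (ae_of_all _ h)
  · rw [integral_undef hf]
    simp only [Complex.zero_im, abs_zero]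
    positivity

/-- The imaginary part enters only through its cosine, hence quadratically. -/
lemma one_sub_re_exp_le (w : ℂ) (hw : w.re ≤ 0) :
    1 - (Complex.exp w).re ≤ |w.re| + w.im ^ 2 := by
  rw [Complex.exp_re, abs_of_nonpos hw]
  have h1 := Real.add_one_le_exp w.re
  have h2 := Real.one_sub_sq_div_two_le_cos (x := w.im)
  have h3 := Real.exp_le_one_iff.2 hw
  have h4 := Real.exp_pos w.re
  nlinarith [sq_nonneg w.im, mul_le_mul_of_nonneg_left h2 h4.le,
    mul_le_mul_of_nonneg_right h3 (sq_nonneg w.im)]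

lemma IsStableLaw.one_sub_re_charFun_le {d : ℕ} {β : ℝ} (hβ : 0 < β) (hβ' : β ≤ 2)
    {μ : Measure (EuclideanSpace ℝ (Fin d))} [IsProbabilityMeasure μ] (h : IsStableLaw β μ) :
    ∃ C, 0 ≤ C ∧ ∀ z, ‖z‖ ≤ 1 → 1 - (charFun μ z).re ≤ C * ‖z‖ ^ β := by
  obtain ⟨Λ, γ, _, h⟩ := h
  obtain ⟨K, hK, him⟩ := exists_abs_stableKernel_im_le β hβ
  refine ⟨Λ.real Set.univ + (K * Λ.real Set.univ + ‖γ‖) ^ 2, by positivity, fun z hz => ?_⟩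
  have hin : ∀ ξ : Metric.sphere (0 : EuclideanSpace ℝ (Fin d)) 1,
      |inner ℝ z (ξ : EuclideanSpace ℝ (Fin d))| ≤ ‖z‖ := fun ξ => by
    simpa using abs_real_inner_le_norm z (ξ : EuclideanSpace ℝ (Fin d))
  have hre := abs_re_integral_le Λ (A := ‖z‖ ^ β) (by positivity)
    (f := fun ξ => stableKernel β (inner ℝ z (ξ : EuclideanSpace ℝ (Fin d)))) (fun ξ => by
      rw [stableKernel_re, abs_of_nonneg (by positivity)]
      exact Real.rpow_le_rpow (abs_nonneg _) (hin ξ) hβ.le)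
  have him' := abs_im_integral_le Λ (A := K * ‖z‖ ^ (β / 2)) (by positivity)
    (f := fun ξ => stableKernel β (inner ℝ z (ξ : EuclideanSpace ℝ (Fin d)))) (fun ξ =>
      (him _ ((hin ξ).trans hz)).trans (mul_le_mul_of_nonneg_left
        (Real.rpow_le_rpow (abs_nonneg _) (hin ξ) (by positivity)) hK))
  set I := ∫ ξ, stableKernel β (inner ℝ z (ξ : EuclideanSpace ℝ (Fin d))) ∂Λ
  have hr : (-I + Complex.I * ((inner ℝ γ z : ℝ) : ℂ)).re = -I.re := by simp
  have hi : (-I + Complex.I * ((inner ℝ γ z : ℝ) : ℂ)).im = -I.im + inner ℝ γ z := by simp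
  -- The sign is read off from `|φ| ≤ 1`, which avoids checking integrability of the kernel.
  have hle : -I.re ≤ 0 := by
    have h1 := norm_charFun_le_one (μ := μ) (t := z)
    rw [h, Complex.norm_exp, hr] at h1
    exact Real.exp_le_one_iff.1 h1
  -- Here `β ≤ 2` is what lets the drift `γ` be absorbed.
  have hzβ : ‖z‖ ≤ ‖z‖ ^ (β / 2) := by
    rcases (norm_nonneg z).eq_or_lt with h0 | h0
    · rw [← h0]; positivity
    · simpa using Real.rpow_le_rpow_of_exponent_ge h0 hz (by linarith : β / 2 ≤ 1)
  have hb : |-I.im + inner ℝ γ z| ≤ (K * Λ.real Set.univ + ‖γ‖) * ‖z‖ ^ (β / 2) := by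
    calc |-I.im + inner ℝ γ z| ≤ |I.im| + |inner ℝ γ z| := by
          simpa using abs_add_le (-I.im) (inner ℝ γ z)
      _ ≤ K * ‖z‖ ^ (β / 2) * Λ.real Set.univ + ‖γ‖ * ‖z‖ :=
          add_le_add him' (abs_real_inner_le_norm γ z)
      _ ≤ K * ‖z‖ ^ (β / 2) * Λ.real Set.univ + ‖γ‖ * ‖z‖ ^ (β / 2) := by gcongr
      _ = _ := by ring
  have hsq : (‖z‖ ^ (β / 2)) ^ 2 = ‖z‖ ^ β := by
    rw [← Real.rpow_natCast, ← Real.rpow_mul (norm_nonneg z)]; norm_num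
  rw [h]
  refine (one_sub_re_exp_le _ (hr ▸ hle)).trans ?_
  rw [hr, hi, abs_neg]
  have := pow_le_pow_left₀ (abs_nonneg _) hb 2
  rw [sq_abs, mul_pow, hsq] at this
  calc |I.re| + (-I.im + inner ℝ γ z) ^ 2 ≤ _ := add_le_add hre this
    _ = _ := by ring

/-! ### Tails from the characteristic function -/

/-- The truncation inequality integrates `1 - φ` over a symmetric interval, so pairing `t` with `-t`
leaves only the real part. The condition `2 ≤ r` keeps that interval inside `[-1, 1]`. -/
lemma measureReal_inner_gt_le_of_charFun {E : Type*} [NormedAddCommGroup E]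
    [InnerProductSpace ℝ E] [MeasurableSpace E] [BorelSpace E] [SecondCountableTopology E]
    {μ : Measure E} [IsProbabilityMeasure μ] {C β : ℝ} (hC : 0 ≤ C) (hβ : 0 < β)
    (h : ∀ z : E, ‖z‖ ≤ 1 → 1 - (charFun μ z).re ≤ C * ‖z‖ ^ β)
    {e : E} (he : ‖e‖ = 1) {r : ℝ} (hr : 2 ≤ r) :
    μ.real {x | r < |inner ℝ e x|} ≤ 2 * C * 2 ^ β * r ^ (-β) := by
  have hr0 : 0 < r := by linarith
  refine (measureReal_abs_inner_gt_le_integral_charFun hr0).trans ?_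
  set f : ℝ → ℂ := fun t => 1 - charFun μ (t • e)
  have hf : Continuous f := by fun_prop
  have hsymm : ∫ t in -2 * r⁻¹..2 * r⁻¹, f t = ∫ t in -2 * r⁻¹..2 * r⁻¹, f (-t) := by
    rw [intervalIntegral.integral_comp_neg]; simp
  have hdouble : 2 * ∫ t in -2 * r⁻¹..2 * r⁻¹, f t
      = ∫ t in -2 * r⁻¹..2 * r⁻¹, (f t + f (-t)) := by
    have hf' : Continuous fun t => f (-t) := hf.comp continuous_neg
    rw [intervalIntegral.integral_add (hf.intervalIntegrable _ _)
      (hf'.intervalIntegrable _ _), ← hsymm, two_mul]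
  have hbound : ‖∫ t in -2 * r⁻¹..2 * r⁻¹, (f t + f (-t))‖
      ≤ 2 * (C * (2 * r⁻¹) ^ β) * |2 * r⁻¹ - (-2 * r⁻¹)| := by
    refine intervalIntegral.norm_integral_le_of_norm_le_const fun t ht => ?_
    have habs : |t| ≤ 2 * r⁻¹ := by
      rw [Set.uIoc_of_le (by have : 0 < r⁻¹ := by positivity
                             linarith)] at ht
      exact abs_le.2 ⟨by linarith [ht.1], ht.2⟩
    have h1 : 2 * r⁻¹ ≤ 1 := by
      rw [← div_eq_mul_inv, div_le_one hr0]; exact hr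
    have heq : f t + f (-t) = ((2 * (1 - (charFun μ (t • e)).re) : ℝ) : ℂ) := by
      simp only [f, neg_smul, charFun_neg]
      apply Complex.ext <;> simp
      ring
    have hn : ‖t • e‖ = |t| := by rw [norm_smul, he, mul_one, Real.norm_eq_abs]
    have hpos : 0 ≤ 1 - (charFun μ (t • e)).re :=
      sub_nonneg.2 ((Complex.re_le_norm _).trans (norm_charFun_le_one _))
    rw [heq, Complex.norm_real, Real.norm_of_nonneg (by positivity)]
    have := h (t • e) (by rw [hn]; linarith)
    rw [hn] at this
    have := this.trans (mul_le_mul_of_nonneg_left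
      (Real.rpow_le_rpow (abs_nonneg t) habs hβ.le) hC)
    linarith
  rw [← hdouble, norm_mul, Complex.norm_ofNat, Real.mul_rpow (by norm_num) (by positivity),
    Real.inv_rpow hr0.le, ← Real.rpow_neg hr0.le, abs_of_pos (by
      have : 0 < r⁻¹ := by positivity
      linarith)] at hbound
  calc 2⁻¹ * r * ‖∫ t in -2 * r⁻¹..2 * r⁻¹, f t‖
      = 4⁻¹ * r * (2 * ‖∫ t in -2 * r⁻¹..2 * r⁻¹, f t‖) := by ring
    _ ≤ 4⁻¹ * r * (2 * (C * (2 ^ β * r ^ (-β))) * (2 * r⁻¹ - -2 * r⁻¹)) := by gcongr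
    _ = 2 * C * 2 ^ β * r ^ (-β) * (r * r⁻¹) := by ring
    _ = _ := by rw [mul_inv_cancel₀ hr0.ne', mul_one]

/-- Below `v₀` the trivial bound `1 = v ^ β * v ^ (-β)` is enough. -/
lemma exists_bound_of_eventual_tail {p : ℝ → ℝ} (hp : ∀ v, p v ≤ 1) {C β v₀ : ℝ}
    (hβ : 0 < β) (h : ∀ v, v₀ ≤ v → p v ≤ C * v ^ (-β)) :
    ∀ v, 0 < v → p v ≤ max C (v₀ ^ β) * v ^ (-β) := by
  intro v hv
  rcases le_or_gt v₀ v with hle | hlt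
  · exact (h v hle).trans (mul_le_mul_of_nonneg_right (le_max_left _ _) (by positivity))
  · refine (hp v).trans ?_
    calc (1 : ℝ) = v ^ β * v ^ (-β) := by rw [← Real.rpow_add hv]; simp
      _ ≤ v₀ ^ β * v ^ (-β) := by gcongr
      _ ≤ _ := mul_le_mul_of_nonneg_right (le_max_right _ _) (by positivity)

/-- The tails of a `β`-stable law are `O(v^(-β))`. -/
lemma IsStableLaw.exists_measureReal_norm_gt_le {d : ℕ} {β : ℝ} (hβ : 0 < β) (hβ' : β ≤ 2)
    {μ : Measure (EuclideanSpace ℝ (Fin d))} [IsProbabilityMeasure μ] (h : IsStableLaw β μ) :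
    ∃ C, ∀ v, 0 < v → μ.real {x | v < ‖x‖} ≤ C * v ^ (-β) := by
  obtain ⟨C, hC, hchar⟩ := h.one_sub_re_charFun_le hβ hβ'
  -- Some coordinate exceeds `v / (d + 1)`, which must be at least `2`. Dividing by `d + 1` instead
  -- of `d` covers `d = 0`.
  refine ⟨_, exists_bound_of_eventual_tail (C := d * (2 * C * 2 ^ β) * (d + 1) ^ β)
    (v₀ := 2 * (d + 1)) (fun v => measureReal_le_one) hβ fun v hv => ?_⟩
  have hd : (0 : ℝ) < d + 1 := by positivity
  have hv0 : 0 < v := lt_of_lt_of_le (by positivity) hv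
  set e : Fin d → EuclideanSpace ℝ (Fin d) := fun i => EuclideanSpace.single i 1
  have hsub : {x : EuclideanSpace ℝ (Fin d) | v < ‖x‖}
      ⊆ ⋃ i : Fin d, {x | v / (d + 1) < |inner ℝ (e i) x|} := by
    intro x hx
    by_contra hcon
    simp only [Set.mem_iUnion, Set.mem_ofPred_eq, not_exists, not_lt, e,
      EuclideanSpace.inner_single_left, map_one, one_mul] at hcon hx
    have h1 : ‖x‖ ≤ ∑ i, |x i| := by
      rw [EuclideanSpace.norm_eq]
      refine Real.sqrt_le_iff.2 ⟨by positivity, ?_⟩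
      simp only [Real.norm_eq_abs]
      exact Finset.sum_sq_le_sq_sum_of_nonneg fun i _ => abs_nonneg _
    have h2 : ∑ i, |x i| ≤ d * (v / (d + 1)) := by
      simpa using Finset.sum_le_sum fun i (_ : i ∈ Finset.univ) => hcon i
    have h3 : d * (v / (d + 1)) ≤ v := by
      rw [← mul_div_assoc, div_le_iff₀ hd]; nlinarith
    linarith
  calc μ.real {x | v < ‖x‖} ≤ ∑ i : Fin d, μ.real {x | v / (d + 1) < |inner ℝ (e i) x|} :=
        (measureReal_mono hsub).trans (measureReal_iUnion_fintype_le _)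
    _ ≤ ∑ i : Fin d, 2 * C * 2 ^ β * (v / (d + 1)) ^ (-β) := by
        refine Finset.sum_le_sum fun i _ => ?_
        exact measureReal_inner_gt_le_of_charFun hC hβ hchar (by simp [e])
          (by rw [le_div_iff₀ hd]; exact hv)
    _ = _ := by
        rw [Finset.sum_const, Finset.card_univ, Fintype.card_fin, nsmul_eq_mul,
          Real.div_rpow hv0.le hd.le, Real.rpow_neg hd.le, div_inv_eq_mul]
        ring

/-! ### Maximal inequalities -/

/-- **Ottaviani's inequality** for the partial sums of independent random vectors. -/
lemma measureReal_exists_norm_sum_gt_le {Ω E : Type*} [MeasurableSpace Ω] {P : Measure Ω}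
    [IsProbabilityMeasure P] [NormedAddCommGroup E] [MeasurableSpace E] [BorelSpace E]
    [SecondCountableTopology E] {D : ℕ → Ω → E} (hD : ∀ i, Measurable (D i))
    (hind : iIndepFun D P) (N : ℕ) {v : ℝ}
    (hv : ∀ j ≤ N, P.real {ω | v < ‖∑ i ∈ Finset.Ico j N, D i ω‖} ≤ 1 / 2) :
    P.real {ω | ∃ j ≤ N, 2 * v < ‖∑ i ∈ Finset.range j, D i ω‖}
      ≤ 2 * P.real {ω | v < ‖∑ i ∈ Finset.range N, D i ω‖} := by
  set S : ℕ → Ω → E := fun j ω => ∑ i ∈ Finset.range j, D i ω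
  set R : ℕ → Ω → E := fun j ω => ∑ i ∈ Finset.Ico j N, D i ω
  -- First-passage decomposition: the `A j` are disjoint, `A j` depends on the `D i` with `i < j`,
  -- and `R j` on those with `i ≥ j`.
  set A : ℕ → Set Ω := fun j => {ω | 2 * v < ‖S j ω‖ ∧ ∀ i < j, ‖S i ω‖ ≤ 2 * v}
  set m : ℕ → MeasurableSpace Ω := fun i => MeasurableSpace.comap (D i) inferInstance
  have hm : ∀ i, m i ≤ ‹MeasurableSpace Ω› := fun i => (hD i).comap_le
  have hDm : ∀ (s : Set ℕ) (i : ℕ), i ∈ s → Measurable[⨆ k ∈ s, m k] (D i) := fun s i hi =>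
    (comap_measurable (D i)).mono (le_iSup₂_of_le i hi le_rfl) le_rfl
  have hS : ∀ j, ∀ i ≤ j, Measurable[⨆ k ∈ Set.Iio j, m k] (S i) := fun j i hij =>
    Finset.measurable_fun_sum _ fun k hk =>
      hDm _ k (lt_of_lt_of_le (Finset.mem_range.1 hk) hij)
  have hR : ∀ j, Measurable[⨆ k ∈ Set.Ici j, m k] (R j) := fun j =>
    Finset.measurable_fun_sum _ fun k hk => hDm _ k (Finset.mem_Ico.1 hk).1
  have hA : ∀ j, MeasurableSet[⨆ k ∈ Set.Iio j, m k] (A j) := by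
    intro j
    have : A j = (fun ω => ‖S j ω‖) ⁻¹' Set.Ioi (2 * v) ∩
        ⋂ i ∈ Set.Iio j, (fun ω => ‖S i ω‖) ⁻¹' Set.Iic (2 * v) := by
      ext ω; simp [A]
    rw [this]
    refine MeasurableSet.inter ((measurable_norm.comp (hS j j le_rfl)) measurableSet_Ioi)
      (MeasurableSet.biInter (Set.to_countable _) fun i hi => ?_)
    exact (measurable_norm.comp (hS j i (le_of_lt hi))) measurableSet_Iic
  have hAm : ∀ j, MeasurableSet (A j) := fun j => iSup₂_le (fun i _ => hm i) _ (hA j)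
  have hRm : ∀ j, Measurable (R j) := fun j => (hR j).mono (iSup₂_le fun i _ => hm i) le_rfl
  have hdisj : ∀ i j, i < j → Disjoint (A i) (A j) := fun i j hij =>
    Set.disjoint_left.2 fun ω hi hj => (hj.2 i hij).not_gt hi.1
  have hdisj' : Pairwise (Function.onFun Disjoint A) := fun i j hij =>
    hij.lt_or_gt.elim (hdisj i j) fun h => (hdisj j i h).symm
  have hunion : {ω | ∃ j ≤ N, 2 * v < ‖S j ω‖} ⊆ ⋃ j ∈ Finset.range (N + 1), A j := by
    classical
    rintro ω ⟨j, hj, hlt⟩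
    have hex : ∃ j, 2 * v < ‖S j ω‖ := ⟨j, hlt⟩
    refine Set.mem_biUnion (x := Nat.find hex) ?_
      ⟨Nat.find_spec hex, fun i hi => not_lt.1 (Nat.find_min hex hi)⟩
    simpa using lt_of_le_of_lt (Nat.find_min' hex hlt) (Nat.lt_succ_of_le hj)
  have hstep : ∀ j ∈ Finset.range (N + 1),
      P.real (A j) ≤ 2 * P.real (A j ∩ {ω | v < ‖S N ω‖}) := by
    intro j hj
    have hjN : j ≤ N := Nat.lt_succ_iff.1 (Finset.mem_range.1 hj)
    set G : Set Ω := {ω | v < ‖R j ω‖}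
    have hG : MeasurableSet[⨆ k ∈ Set.Ici j, m k] G :=
      (measurable_norm.comp (hR j)) measurableSet_Ioi
    have hGm : MeasurableSet G := (hRm j).norm measurableSet_Ioi
    have hindep : Indep (⨆ k ∈ Set.Iio j, m k) (⨆ k ∈ Set.Ici j, m k) P :=
      indep_iSup_of_disjoint hm hind
        (Set.Iio_disjoint_Ici le_rfl)
    have hprod : P.real (A j ∩ G) = P.real (A j) * P.real G := by
      simp only [Measure.real, (Indep_iff _ _ _).1 hindep _ _ (hA j) hG, ENNReal.toReal_mul]
    -- If `‖R j‖ ≤ v`, the triangle inequality leaves `‖S N‖ > 2v - v`. The other case has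
    -- probability at most `P (A j) / 2` and is absorbed on the left.
    have hsub : A j ⊆ (A j ∩ G) ∪ (A j ∩ {ω | v < ‖S N ω‖}) := by
      intro ω hω
      by_cases h : v < ‖R j ω‖
      · exact Or.inl ⟨hω, h⟩
      · refine Or.inr ⟨hω, ?_⟩
        have hsplit : S N ω = S j ω + R j ω := (Finset.sum_range_add_sum_Ico _ hjN).symm
        have h1 := hω.1
        have h2 : ‖S j ω‖ ≤ ‖S N ω‖ + ‖R j ω‖ := by
          rw [hsplit]; simpa using norm_sub_le (S j ω + R j ω) (R j ω)
        simp only [Set.mem_ofPred_eq]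
        linarith
    have := (measureReal_mono hsub (μ := P)).trans (measureReal_union_le _ _)
    rw [hprod] at this
    have := mul_le_mul_of_nonneg_left (hv j hjN) (measureReal_nonneg (μ := P) (s := A j))
    linarith
  calc P.real {ω | ∃ j ≤ N, 2 * v < ‖S j ω‖} ≤ P.real (⋃ j ∈ Finset.range (N + 1), A j) :=
        measureReal_mono hunion (measure_ne_top _ _)
    _ ≤ ∑ j ∈ Finset.range (N + 1), P.real (A j) := measureReal_biUnion_finset_le _ _
    _ ≤ ∑ j ∈ Finset.range (N + 1), 2 * P.real (A j ∩ {ω | v < ‖S N ω‖}) :=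
        Finset.sum_le_sum hstep
    _ = 2 * P.real (⋃ j ∈ Finset.range (N + 1), (A j ∩ {ω | v < ‖S N ω‖})) := by
        rw [← Finset.mul_sum, measureReal_biUnion_finset]
        · exact fun i _ j _ hij => (hdisj' hij).mono Set.inter_subset_left Set.inter_subset_left
        · refine fun j _ => (hAm j).inter ?_
          exact (Finset.measurable_fun_sum _ fun i _ => hD i).norm measurableSet_Ioi
    _ ≤ 2 * P.real {ω | v < ‖S N ω‖} := by
        gcongr
        · exact measure_ne_top _ _
        · exact Set.iUnion₂_subset fun j _ => Set.inter_subset_right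

/-- One-sided limits bound `f` near each point; compactness does the rest. -/
lemma exists_norm_le_of_cadlag {E : Type*} [NormedAddCommGroup E] {f : ℝ≥0 → E}
    (hf : ∀ s, ContinuousWithinAt f (Set.Ici s) s ∧ ∃ l, Tendsto f (𝓝[<] s) (𝓝 l)) (b : ℝ≥0) :
    ∃ C, ∀ s ≤ b, ‖f s‖ ≤ C := by
  suffices ∃ C, ∀ s ∈ Set.Icc 0 b, ‖f s‖ ≤ C by
    obtain ⟨C, hC⟩ := this
    exact ⟨C, fun s hs => hC s ⟨zero_le, hs⟩⟩
  refine isCompact_Icc.induction_on (p := fun t => ∃ C, ∀ s ∈ t, ‖f s‖ ≤ C) ⟨0, by simp⟩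
    (fun s t hst ⟨C, hC⟩ => ⟨C, fun x hx => hC x (hst hx)⟩) ?_ fun s _ => ?_
  · rintro s t ⟨C, hC⟩ ⟨C', hC'⟩
    refine ⟨max C C', fun x hx => ?_⟩
    rcases hx with hx | hx
    exacts [(hC x hx).trans (le_max_left _ _), (hC' x hx).trans (le_max_right _ _)]
  · obtain ⟨hr, l, hl⟩ := hf s
    have h1 : ∀ᶠ x in 𝓝[<] s, ‖f x‖ ≤ ‖l‖ + 1 :=
      hl.norm.eventually_le_const (by linarith)
    have h2 : ∀ᶠ x in 𝓝[≥] s, ‖f x‖ ≤ ‖f s‖ + 1 :=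
      hr.norm.eventually_le_const (by linarith)
    refine ⟨{x | ‖f x‖ ≤ max (‖l‖ + 1) (‖f s‖ + 1)}, mem_nhdsWithin_of_mem_nhds ?_,
      ⟨_, fun x hx => hx⟩⟩
    rw [← nhdsLT_sup_nhdsGE s]
    exact ⟨h1.mono fun x hx => hx.trans (le_max_left _ _),
      h2.mono fun x hx => hx.trans (le_max_right _ _)⟩

section Levy

variable {Ω E : Type*} [MeasurableSpace Ω] {P : Measure Ω}
  [NormedAddCommGroup E] [MeasurableSpace E] [BorelSpace E] {X : ℝ≥0 → Ω → E}

/-- On the dyadic rationals of `[0, 1]`, the one-dimensional laws of a Lévy process are tight. -/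
lemma IsLevyProcess.exists_measureReal_dyadic_le [IsProbabilityMeasure P]
    (hX : IsLevyProcess X P) {ε : ℝ} (hε : 0 < ε) :
    ∃ v₀ : ℝ, 0 < v₀ ∧ ∀ v, v₀ ≤ v → ∀ m j : ℕ, j ≤ 2 ^ m →
      P.real {ω | v < ‖X ((j : ℝ≥0) / 2 ^ m) ω‖} ≤ ε := by
  -- Càdlàg paths are bounded on `[0, 1]`, so these events decrease to a null set, which yields one
  -- threshold for all dyadic times.
  set B : ℕ → Set Ω := fun n => ⋃ (m : ℕ) (j : ℕ) (_ : j ≤ 2 ^ m),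
    {ω | (n : ℝ) + 1 < ‖X ((j : ℝ≥0) / 2 ^ m) ω‖}
  have hB : ∀ n, MeasurableSet (B n) := fun n =>
    MeasurableSet.iUnion fun m => MeasurableSet.iUnion fun j => MeasurableSet.iUnion fun _ =>
      (hX.measurable _).norm measurableSet_Ioi
  have hanti : Antitone B := by
    intro n n' hn
    refine Set.iUnion_mono fun m => Set.iUnion_mono fun j => Set.iUnion_mono fun _ ω hω => ?_
    have : (n : ℝ) ≤ n' := by exact_mod_cast hn
    simp only [Set.mem_ofPred_eq] at hω ⊢
    linarith
  have hnull : P (⋂ n, B n) = 0 := by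
    refine measure_mono_null (t := {ω | ¬ ∀ s, ContinuousWithinAt (fun r => X r ω) (Set.Ici s) s ∧
      ∃ l, Tendsto (fun r => X r ω) (𝓝[<] s) (𝓝 l)}) (fun ω hω hc => ?_) (ae_iff.1 hX.cadlag)
    obtain ⟨C, hC⟩ := exists_norm_le_of_cadlag hc 1
    obtain ⟨n, hn⟩ := exists_nat_ge C
    have := Set.mem_iInter.1 hω n
    simp only [B, Set.mem_iUnion, Set.mem_ofPred_eq] at this
    obtain ⟨m, j, hj, hlt⟩ := this
    have h1 : (j : ℝ≥0) / 2 ^ m ≤ 1 := by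
      rw [div_le_one (by positivity)]; exact_mod_cast hj
    have := hC _ h1
    linarith
  have htend := tendsto_measure_iInter_atTop (μ := P) (fun n => (hB n).nullMeasurableSet) hanti
    ⟨0, measure_ne_top _ _⟩
  rw [hnull] at htend
  obtain ⟨n, hn⟩ := (htend.eventually_le_const (ENNReal.ofReal_pos.2 hε)).exists
  refine ⟨n + 1, by positivity, fun v hv m j hj => ?_⟩
  refine (measureReal_mono (s₂ := B n) fun ω hω => ?_).trans (ENNReal.toReal_le_of_le_ofReal hε.le hn)
  simp only [B, Set.mem_iUnion, Set.mem_ofPred_eq] at hω ⊢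
  exact ⟨m, j, hj, by linarith⟩

lemma IsLevyProcess.measureReal_norm_sub_gt (hX : IsLevyProcess X P) (s h : ℝ≥0) (v : ℝ) :
    P.real {ω | v < ‖X (s + h) ω - X s ω‖} = P.real {ω | v < ‖X h ω‖} := by
  have := (hX.stationaryIncrements s h).measure_mem_eq
    (s := {x : E | v < ‖x‖}) (measurable_norm measurableSet_Ioi)
  exact congrArg ENNReal.toReal this

/-- Ottaviani's inequality for the increments along a grid of mesh `2^(-m)`. Tightness with `ε = 1 /
2` supplies its hypothesis, and stationarity makes `v₀` independent of `k` and `m`. -/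
lemma IsLevyProcess.exists_measureReal_dyadic_chain_le [IsProbabilityMeasure P]
    [SecondCountableTopology E] (hX : IsLevyProcess X P) :
    ∃ v₀ : ℝ, 0 < v₀ ∧ ∀ v, v₀ ≤ v → ∀ k m : ℕ,
      P.real {ω | ∃ j : ℕ, j ≤ 2 ^ m ∧ 2 * v < ‖X ((k : ℝ≥0) + (j : ℝ≥0) / 2 ^ m) ω - X k ω‖}
        ≤ 2 * P.real {ω | v < ‖X 1 ω‖} := by
  obtain ⟨v₀, hv₀, htight⟩ := hX.exists_measureReal_dyadic_le (ε := 1 / 2) (by norm_num)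
  refine ⟨v₀, hv₀, fun v hv k m => ?_⟩
  set t : ℕ → ℝ≥0 := fun j => (k : ℝ≥0) + (j : ℝ≥0) / 2 ^ m
  have ht : Monotone t := fun i j hij => by
    simp only [t]; gcongr
  have ht0 : t 0 = k := by simp [t]
  have htN : t (2 ^ m) = k + 1 := by simp [t]
  have hsum : ∀ ω j, ∑ i ∈ Finset.range j, (X (t (i + 1)) ω - X (t i) ω) = X (t j) ω - X k ω :=
    fun ω j => by rw [Finset.sum_range_sub (fun i => X (t i) ω), ht0]
  have hsum' : ∀ ω, ∀ j ≤ 2 ^ m, ∑ i ∈ Finset.Ico j (2 ^ m), (X (t (i + 1)) ω - X (t i) ω)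
      = X (t (2 ^ m)) ω - X (t j) ω :=
    fun ω j hj => Finset.sum_Ico_sub (fun i => X (t i) ω) hj
  have hott := measureReal_exists_norm_sum_gt_le (P := P)
    (D := fun i ω => X (t (i + 1)) ω - X (t i) ω)
    (fun i => (hX.measurable _).sub (hX.measurable _)) (hX.indepIncrements.nat ht) (2 ^ m)
    (v := v) fun j hj => by
      simp only [hsum' _ j hj]
      have : t (2 ^ m) = t j + ((2 ^ m - j : ℕ) : ℝ≥0) / 2 ^ m := by
        simp only [t]
        rw [add_assoc, ← add_div, ← Nat.cast_add, Nat.add_sub_cancel' hj]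
      rw [this, hX.measureReal_norm_sub_gt]
      exact htight v hv m _ (Nat.sub_le _ _)
  simp only [hsum, htN] at hott
  rwa [hX.measureReal_norm_sub_gt] at hott

/-- A Lévy maximal inequality over the dyadic points of `[k, k + 1]`. -/
lemma IsLevyProcess.exists_measureReal_dyadic_sup_le [IsProbabilityMeasure P]
    [SecondCountableTopology E] (hX : IsLevyProcess X P) :
    ∃ v₀ : ℝ, 0 < v₀ ∧ ∀ v, v₀ ≤ v → ∀ k : ℕ,
      P.real {ω | ∃ m j : ℕ, j ≤ 2 ^ m ∧
        2 * v < ‖X ((k : ℝ≥0) + (j : ℝ≥0) / 2 ^ m) ω - X k ω‖}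
        ≤ 2 * P.real {ω | v < ‖X 1 ω‖} := by
  obtain ⟨v₀, hv₀, h⟩ := hX.exists_measureReal_dyadic_chain_le
  refine ⟨v₀, hv₀, fun v hv k => ?_⟩
  set B : ℕ → Set Ω := fun m =>
    {ω | ∃ j : ℕ, j ≤ 2 ^ m ∧ 2 * v < ‖X ((k : ℝ≥0) + (j : ℝ≥0) / 2 ^ m) ω - X k ω‖}
  -- The grids are nested, so the bound, uniform in `m`, survives the limit by continuity from
  -- below.
  have hmono : Monotone B := by
    refine monotone_nat_of_le_succ fun m ω => ?_
    rintro ⟨j, hj, hlt⟩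
    refine ⟨2 * j, by rw [pow_succ]; omega, ?_⟩
    have : ((2 * j : ℕ) : ℝ≥0) / 2 ^ (m + 1) = (j : ℝ≥0) / 2 ^ m := by
      rw [pow_succ', Nat.cast_mul, Nat.cast_ofNat, mul_div_mul_left _ _ two_ne_zero]
    rwa [this]
  have hU : {ω | ∃ m j : ℕ, j ≤ 2 ^ m ∧
        2 * v < ‖X ((k : ℝ≥0) + (j : ℝ≥0) / 2 ^ m) ω - X k ω‖} = ⋃ m, B m := by
    ext ω; simp [B]
  rw [hU]
  refine ENNReal.toReal_le_of_le_ofReal (by positivity) ?_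
  rw [hmono.measure_iUnion]
  exact iSup_le fun m => ENNReal.le_ofReal_iff_toReal_le (measure_ne_top _ _) (by positivity) |>.2
    (h v hv k m)

lemma IsLevyProcess.exists_measureReal_dyadic_sup_rpow_le [IsProbabilityMeasure P]
    [SecondCountableTopology E] (hX : IsLevyProcess X P) {β C : ℝ}
    (hβ : 0 < β) (hC : ∀ v, 0 < v → P.real {ω | v < ‖X 1 ω‖} ≤ C * v ^ (-β)) :
    ∃ C', 0 ≤ C' ∧ ∀ v, 0 < v → ∀ k : ℕ,
      P.real {ω | ∃ m j : ℕ, j ≤ 2 ^ m ∧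
        v < ‖X ((k : ℝ≥0) + (j : ℝ≥0) / 2 ^ m) ω - X k ω‖} ≤ C' * v ^ (-β) := by
  obtain ⟨v₀, hv₀, h⟩ := hX.exists_measureReal_dyadic_sup_le
  refine ⟨max (2 * C * 2 ^ β) ((2 * v₀) ^ β), le_max_of_le_right (by positivity), fun v hv k =>
    exists_bound_of_eventual_tail (p := fun v => P.real {ω | ∃ m j : ℕ, j ≤ 2 ^ m ∧
        v < ‖X ((k : ℝ≥0) + (j : ℝ≥0) / 2 ^ m) ω - X k ω‖}) (fun v => measureReal_le_one)
      hβ (fun v hv => ?_) v hv⟩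
  have hv0 : 0 < v := by linarith
  have h1 := h (v / 2) (by linarith) k
  rw [mul_div_cancel₀ v two_ne_zero] at h1
  refine h1.trans ?_
  have h2 := hC (v / 2) (by linarith)
  rw [Real.div_rpow hv0.le zero_le_two, Real.rpow_neg zero_le_two, div_inv_eq_mul] at h2
  calc _ ≤ 2 * (C * (v ^ (-β) * 2 ^ β)) := by linarith
    _ = _ := by ring

end Levy

/-! ### Exponential bounds for the subordinator -/

lemma integrableOn_exp_sub_one_mul_rpow {α : ℝ} (hα : 0 < α) (hα' : α < 1) (c : ℝ) :
    IntegrableOn (fun x : ℝ => (Complex.exp (Complex.I * x) - 1) *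
      ((c * x ^ (-α - 1) : ℝ) : ℂ)) (Set.Ioi 0) := by
  have hmeas : Measurable fun x : ℝ => (Complex.exp (Complex.I * x) - 1) *
      ((c * x ^ (-α - 1) : ℝ) : ℂ) := by fun_prop
  rw [← Set.Ioc_union_Ioi_eq_Ioi zero_le_one, integrableOn_union]
  constructor
  · have hint : IntegrableOn (fun x : ℝ => |c| * x ^ (-α)) (Set.Ioc 0 1) :=
      ((intervalIntegrable_iff_integrableOn_Ioc_of_le zero_le_one).1
        (intervalIntegral.intervalIntegrable_rpow' (by linarith))).const_mul _
    refine hint.mono' hmeas.aestronglyMeasurable ?_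
    filter_upwards [ae_restrict_mem measurableSet_Ioc] with x hx
    have hx0 : 0 < x := hx.1
    rw [norm_mul, Complex.norm_real, norm_mul, Real.norm_eq_abs c,
      Real.norm_of_nonneg (Real.rpow_nonneg hx0.le _)]
    have h1 : ‖Complex.exp (Complex.I * x) - 1‖ ≤ x := by
      simpa [abs_of_pos hx0] using Real.norm_exp_I_mul_ofReal_sub_one_le (x := x)
    calc ‖Complex.exp (Complex.I * x) - 1‖ * (|c| * x ^ (-α - 1))
        ≤ x * (|c| * x ^ (-α - 1)) := by gcongr
      _ = |c| * (x ^ (-α - 1) * x) := by ring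
      _ = |c| * x ^ (-α) := by rw [← Real.rpow_add_one hx0.ne']; ring_nf
  · have hint : IntegrableOn (fun x : ℝ => 2 * |c| * x ^ (-α - 1)) (Set.Ioi 1) :=
      (integrableOn_Ioi_rpow_of_lt (by linarith) one_pos).const_mul _
    refine hint.mono' hmeas.aestronglyMeasurable ?_
    filter_upwards [ae_restrict_mem measurableSet_Ioi] with x hx
    have hx0 : 0 < x := one_pos.trans hx
    rw [norm_mul, Complex.norm_real, norm_mul, Real.norm_eq_abs c,
      Real.norm_of_nonneg (Real.rpow_nonneg hx0.le _), mul_assoc]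
    gcongr
    refine (norm_sub_le _ _).trans ?_
    rw [mul_comm, Complex.norm_exp_ofReal_mul_I, norm_one]
    norm_num

/-- The negated real part is the integral of `(1 - cos x) c x^(-α - 1)`, which is nonnegative and
positive on `(0, 1)`. -/
lemma re_integral_exp_sub_one_mul_rpow_neg {α c : ℝ} (hα : 0 < α) (hα' : α < 1) (hc : 0 < c) :
    (∫ x in Set.Ioi (0 : ℝ), (Complex.exp (Complex.I * x) - 1) *
      ((c * x ^ (-α - 1) : ℝ) : ℂ)).re < 0 := by
  have hint := integrableOn_exp_sub_one_mul_rpow hα hα' c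
  have hre := integral_re hint
  simp only [RCLike.re_eq_complex_re] at hre
  rw [← hre, ← neg_pos, ← integral_neg]
  have heq : ∀ x : ℝ, -((Complex.exp (Complex.I * x) - 1) * ((c * x ^ (-α - 1) : ℝ) : ℂ)).re
      = (1 - Real.cos x) * (c * x ^ (-α - 1)) := fun x => by
    rw [Complex.re_mul_ofReal, Complex.sub_re, mul_comm Complex.I, Complex.exp_ofReal_mul_I_re,
      Complex.one_re]
    ring
  rw [setIntegral_pos_iff_support_of_nonneg_ae]
  · have hsub : Set.Ioo (0 : ℝ) 1 ⊆ Function.support (fun x : ℝ =>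
        -((Complex.exp (Complex.I * x) - 1) * ((c * x ^ (-α - 1) : ℝ) : ℂ)).re) ∩ Set.Ioi 0 := by
      intro x hx
      refine ⟨?_, hx.1⟩
      rw [Function.mem_support, heq]
      have h1 := Real.cos_lt_cos_of_nonneg_of_le_pi le_rfl
        (by linarith [hx.2, Real.pi_gt_three] : x ≤ Real.pi) hx.1
      rw [Real.cos_zero] at h1
      exact (mul_pos (by linarith) (mul_pos hc (Real.rpow_pos_of_pos hx.1 _))).ne'
    exact lt_of_lt_of_le (by simp) (measure_mono hsub)
  · filter_upwards [ae_restrict_mem measurableSet_Ioi] with x hx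
    rw [heq]
    have := Real.cos_le_one x
    have : 0 ≤ x ^ (-α - 1) := Real.rpow_nonneg (le_of_lt hx) _
    exact mul_nonneg (by linarith) (by positivity)
  · exact hint.re.neg

section Subordinator

variable {Ω : Type*} [MeasurableSpace Ω] {P : Measure Ω} {α : ℝ}
  {τ : ℝ≥0 → Ω → ℝ}

/-- Otherwise the characteristic function would be `1`, but its modulus at `z = 1` is less than `1`.
-/
lemma IsStableSubordinator.not_ae_eq_zero [IsProbabilityMeasure P]
    (hα : 0 < α) (hα' : α < 1)
    (hτ : IsStableSubordinator α τ P) : ¬ τ 1 =ᵐ[P] 0 := by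
  intro h
  have h1 := hτ.charFun_one 1
  have hΓ : 0 < Real.Gamma (1 - α) := Real.Gamma_pos_of_pos (by linarith)
  have h2 := re_integral_exp_sub_one_mul_rpow_neg hα hα' (div_pos hα hΓ)
  rw [Measure.map_congr h] at h1
  have h3 : charFun (P.map (0 : Ω → ℝ)) 1 = 1 := by
    change charFun (P.map (fun _ : Ω => (0 : ℝ))) 1 = 1
    rw [Measure.map_const, measure_univ, one_smul, charFun_dirac]
    simp
  rw [h3] at h1
  have h4 := congrArg norm h1
  rw [norm_one, Complex.norm_exp] at h4
  have h5 := Real.exp_eq_one_iff _ |>.1 h4.symm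
  simp only [Complex.ofReal_one, mul_one] at h5
  exact h2.ne h5

lemma IsStableSubordinator.ae_nonneg (hτ : IsStableSubordinator α τ P) (s : ℝ≥0) :
    0 ≤ᵐ[P] τ s := by
  filter_upwards [hτ.monotone, hτ.isLevyProcess.zero] with ω hω h0
  simpa [h0] using hω (zero_le : 0 ≤ s)

lemma IsStableSubordinator.integrable_exp_neg [IsProbabilityMeasure P]
    (hτ : IsStableSubordinator α τ P) (s : ℝ≥0) :
    Integrable (fun ω => Real.exp (-1 * τ s ω)) P := by
  refine Integrable.of_bound
    ((hτ.isLevyProcess.measurable s).const_mul _).exp.aestronglyMeasurable 1 ?_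
  filter_upwards [hτ.ae_nonneg s] with ω hω
  rw [Real.norm_of_nonneg (Real.exp_pos _).le]
  simp only [Pi.zero_apply] at hω
  exact Real.exp_le_one_iff.2 (by linarith)

lemma IsStableSubordinator.mgf_neg_one_lt_one [IsProbabilityMeasure P]
    (hα : 0 < α) (hα' : α < 1)
    (hτ : IsStableSubordinator α τ P) : mgf (τ 1) P (-1) < 1 := by
  have hint := hτ.integrable_exp_neg 1
  have hnn : 0 ≤ᵐ[P] fun ω => 1 - Real.exp (-1 * τ 1 ω) := by
    filter_upwards [hτ.ae_nonneg 1] with ω hω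
    simp only [Pi.zero_apply] at hω ⊢
    exact sub_nonneg.2 (Real.exp_le_one_iff.2 (by linarith))
  have hI : ∫ ω, (1 - Real.exp (-1 * τ 1 ω)) ∂P = 1 - mgf (τ 1) P (-1) := by
    rw [integral_sub (integrable_const _) hint]
    simp [mgf]
  have h0 : 0 ≤ 1 - mgf (τ 1) P (-1) := hI ▸ integral_nonneg_of_ae hnn
  refine lt_of_le_of_ne (by linarith) fun heq => hτ.not_ae_eq_zero hα hα' ?_
  rw [heq, sub_self, integral_eq_zero_iff_of_nonneg_ae hnn ((integrable_const _).sub hint)] at hI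
  filter_upwards [hI] with ω hω
  simp only [Pi.zero_apply] at hω ⊢
  have := (Real.exp_eq_one_iff _).1 (sub_eq_zero.1 hω).symm
  linarith

lemma IsStableSubordinator.mgf_neg_one_natCast [IsProbabilityMeasure P]
    (hτ : IsStableSubordinator α τ P) (n : ℕ) :
    mgf (τ n) P (-1) = mgf (τ 1) P (-1) ^ n := by
  have hL := hτ.isLevyProcess
  induction n with
  | zero =>
    have : τ ((0 : ℕ) : ℝ≥0) =ᵐ[P] fun _ => 0 := by
      filter_upwards [hL.zero] with ω hω
      simpa using hω
    rw [mgf_congr this]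
    simp [mgf]
  | succ n ih =>
    have hsplit : τ ((n + 1 : ℕ) : ℝ≥0) = τ n + (τ (n + 1) - τ n) := by
      push_cast; abel
    have hid : mgf (τ (n + 1) - τ n) P (-1) = mgf (τ 1) P (-1) :=
      ((hL.stationaryIncrements n 1).comp (u := fun x => Real.exp (-1 * x)) (by fun_prop)).integral_eq
    have hind : τ n ⟂ᵢ[P] (τ (n + 1) - τ n) :=
      hL.indepIncrements.indepFun_eval_sub (zero_le : (0 : ℝ≥0) ≤ n) le_self_add hL.zero
    rw [hsplit, hind.mgf_add, hid, ih, pow_succ]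
    · exact ((hL.measurable _).const_mul _).exp.aestronglyMeasurable
    · exact (((hL.measurable _).sub (hL.measurable _)).const_mul _).exp.aestronglyMeasurable

/-- A stable subordinator stays below a fixed level for a time with exponential tails. -/
lemma IsStableSubordinator.measureReal_le [IsProbabilityMeasure P]
    (hτ : IsStableSubordinator α τ P) (c : ℝ) (n : ℕ) :
    P.real {ω | τ n ω ≤ c} ≤ Real.exp c * mgf (τ 1) P (-1) ^ n := by
  have := measure_le_le_exp_mul_mgf (μ := P) (X := τ n) (t := -1) c (by norm_num)
    (hτ.integrable_exp_neg n)
  rwa [hτ.mgf_neg_one_natCast, neg_neg, one_mul] at this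

end Subordinator

/-! ### Evaluation at the inverse time -/

/-- Right-continuity at `s ∈ [n, n + 1)` gives a dyadic point of `[n, n + 1]` in any open set that
contains `f s`. -/
lemma exists_dyadic_mem_of_continuousWithinAt {E : Type*} [TopologicalSpace E] {f : ℝ≥0 → E}
    {s : ℝ≥0} (hf : ContinuousWithinAt f (Set.Ici s) s) {n : ℕ} (hn : (n : ℝ≥0) ≤ s)
    (hn' : s < n + 1) {U : Set E} (hU : IsOpen U) (hs : f s ∈ U) :
    ∃ m j : ℕ, j ≤ 2 ^ m ∧ f ((n : ℝ≥0) + (j : ℝ≥0) / 2 ^ m) ∈ U := by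
  -- Rounding up approaches `s` from the right, where `f` is continuous.
  set j : ℕ → ℕ := fun m => ⌈(s - n) * 2 ^ m⌉₊
  have hj : ∀ m, j m ≤ 2 ^ m := fun m => by
    refine Nat.ceil_le.2 ?_
    have : s - n ≤ 1 := by rw [tsub_le_iff_left]; exact hn'.le
    push_cast
    exact mul_le_of_le_one_left (by positivity) this
  have hlow : ∀ m, s ≤ (n : ℝ≥0) + (j m : ℝ≥0) / 2 ^ m := fun m => by
    rw [← tsub_le_iff_left, le_div_iff₀ (by positivity)]
    exact Nat.le_ceil _
  have hup : ∀ m, (n : ℝ≥0) + (j m : ℝ≥0) / 2 ^ m ≤ s + (1 / 2) ^ m := fun m => by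
    have h1 : (j m : ℝ≥0) ≤ (s - n) * 2 ^ m + 1 := (Nat.ceil_lt_add_one zero_le).le
    have h2 : (j m : ℝ≥0) / 2 ^ m ≤ (s - n) + (1 / 2) ^ m := by
      rw [div_le_iff₀ (by positivity), add_mul, ← mul_pow]
      simpa using h1
    calc (n : ℝ≥0) + (j m : ℝ≥0) / 2 ^ m ≤ n + ((s - n) + (1 / 2) ^ m) := by gcongr
      _ = s + (1 / 2) ^ m := by rw [← add_assoc, add_tsub_cancel_of_le hn]
  have hlim : Tendsto (fun m => s + (1 / 2 : ℝ≥0) ^ m) atTop (𝓝 s) := by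
    simpa using (tendsto_const_nhds (x := s)).add
      (tendsto_pow_atTop_nhds_zero_of_lt_one (r := (1 / 2 : ℝ≥0)) zero_le
        (by rw [div_lt_one] <;> norm_num))
  have htend : Tendsto (fun m => (n : ℝ≥0) + (j m : ℝ≥0) / 2 ^ m) atTop (𝓝[≥] s) :=
    tendsto_nhdsWithin_iff.2
      ⟨tendsto_of_tendsto_of_tendsto_of_le_of_le tendsto_const_nhds hlim hlow hup,
        Eventually.of_forall hlow⟩
  obtain ⟨m, hm⟩ := ((hf.tendsto.comp htend).eventually (hU.mem_nhds hs)).exists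
  exact ⟨m, j m, hj m, hm⟩

/-- If the defining set is empty, its infimum is `0` and `h` cannot hold. -/
lemma le_of_lt_inverseTime {Ω : Type*} {τ : ℝ≥0 → Ω → ℝ} {a t : ℝ} {ω : Ω} {s : ℝ≥0} (hs : 0 < s)
    (h : s < inverseTime τ a t ω) : τ s ω ≤ t - a := by
  have := notMem_of_lt_csInf h (OrderBot.bddBelow _)
  simp only [Set.mem_ofPred_eq, not_and, not_lt] at this
  linarith [this hs]

/-- Pigeonhole on a telescoping sum of `n` full unit increments and a final partial one. -/
lemma exists_dyadic_increment_gt {E : Type*} [NormedAddCommGroup E] {f : ℝ≥0 → E} (h0 : f 0 = 0)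
    {n m j : ℕ} (hj : j ≤ 2 ^ m) {w : ℝ} (hw : w < ‖f ((n : ℝ≥0) + (j : ℝ≥0) / 2 ^ m)‖) :
    ∃ k ∈ Finset.range (n + 1), ∃ m j : ℕ, j ≤ 2 ^ m ∧
      w / (n + 1) < ‖f ((k : ℝ≥0) + (j : ℝ≥0) / 2 ^ m) - f k‖ := by
  by_contra hcon
  push Not at hcon
  have hsum : f ((n : ℝ≥0) + (j : ℝ≥0) / 2 ^ m)
      = ∑ k ∈ Finset.range n, (f ((k : ℝ≥0) + 1) - f k)
        + (f ((n : ℝ≥0) + (j : ℝ≥0) / 2 ^ m) - f n) := by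
    have := Finset.sum_range_sub (fun k : ℕ => f (k : ℝ≥0)) n
    simp only [Nat.cast_add, Nat.cast_one, Nat.cast_zero, h0, sub_zero] at this
    rw [this]; abel
  -- A full block is the dyadic point with `m = 0`, `j = 1`.
  have h1 : ∀ k ∈ Finset.range n, ‖f ((k : ℝ≥0) + 1) - f k‖ ≤ w / (n + 1) := fun k hk => by
    simpa using hcon k (Finset.mem_range.2 ((Finset.mem_range.1 hk).trans n.lt_succ_self)) 0 1
      le_rfl
  have h2 := hcon n (Finset.self_mem_range_succ n) m j hj
  have h3 : ‖f ((n : ℝ≥0) + (j : ℝ≥0) / 2 ^ m)‖ ≤ n * (w / (n + 1)) + w / (n + 1) := by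
    rw [hsum]
    refine (norm_add_le _ _).trans (add_le_add ?_ h2)
    simpa using (norm_sum_le _ _).trans (Finset.sum_le_sum h1)
  have h4 : n * (w / (n + 1)) + w / (n + 1) = w := by
    field_simp
  linarith

lemma summable_geometric_mul_rpow {ρ β : ℝ} (A : ℝ) (hβ : β ≤ 2) (hρ : 0 ≤ ρ) (hρ' : ρ < 1) :
    Summable fun n : ℕ => A * ρ ^ (n - 1) * ((n + 1) * (n + 1 : ℝ) ^ β) := by
  simp_rw [mul_assoc]
  refine Summable.mul_left A ?_
  -- The shift removes the truncated subtraction; the majorant below expands `(n + 2)^3`.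
  rw [← summable_nat_add_iff 1]
  have hp : ∀ k : ℕ, Summable fun n : ℕ => (n : ℝ) ^ k * ρ ^ n := fun k =>
    summable_pow_mul_geometric_of_norm_lt_one k (by rwa [Real.norm_of_nonneg hρ])
  refine Summable.of_nonneg_of_le (fun n => by positivity) (fun n => ?_)
    (((hp 3).add ((hp 2).mul_left 6)).add (((hp 1).mul_left 12).add ((hp 0).mul_left 8)))
  have h1 : ((n : ℝ) + 2) ^ β ≤ (n + 2) ^ 2 := by
    rw [← Real.rpow_natCast]
    exact Real.rpow_le_rpow_of_exponent_le (by linarith [n.cast_nonneg (α := ℝ)]) (by simpa)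
  have h2 : ((n + 1 : ℕ) : ℝ) + 1 = n + 2 := by push_cast; ring
  rw [h2, Nat.add_sub_cancel]
  calc ρ ^ n * (((n : ℝ) + 2) * (n + 2) ^ β) ≤ ρ ^ n * ((n + 2) * (n + 2) ^ 2) := by gcongr
    _ = _ := by ring

/-- The event that an increment of `f` between `k` and a dyadic point of `[k, k + 1]` has norm
greater than `v`. -/
def largeIncrement {E : Type*} [NormedAddCommGroup E] (k : ℕ) (v : ℝ) : Set (ℝ≥0 → E) :=
  {f | ∃ m j : ℕ, j ≤ 2 ^ m ∧ v < ‖f ((k : ℝ≥0) + (j : ℝ≥0) / 2 ^ m) - f k‖}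

lemma measurableSet_largeIncrement {E : Type*} [NormedAddCommGroup E] [MeasurableSpace E]
    [BorelSpace E] [SecondCountableTopology E] (k : ℕ) (v : ℝ) :
    MeasurableSet (largeIncrement (E := E) k v) := by
  have : largeIncrement (E := E) k v = ⋃ (m : ℕ) (j : ℕ) (_ : j ≤ 2 ^ m),
      {f | v < ‖f ((k : ℝ≥0) + (j : ℝ≥0) / 2 ^ m) - f k‖} := by
    ext f; simp [largeIncrement]
  rw [this]
  refine MeasurableSet.iUnion fun m => MeasurableSet.iUnion fun j => MeasurableSet.iUnion fun _ => ?_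
  exact measurableSet_lt measurable_const (by fun_prop)

/-- A Lévy process with tails `O(v^(-β))`, evaluated at an independent inverse subordinator, has
tails `O(v^(-β))`. -/
lemma exists_measureReal_inverseTime_le {Ω E : Type*} [MeasurableSpace Ω] {P : Measure Ω}
    [IsProbabilityMeasure P] [NormedAddCommGroup E] [MeasurableSpace E] [BorelSpace E]
    [SecondCountableTopology E] {X : ℝ≥0 → Ω → E} {τ : ℝ≥0 → Ω → ℝ} {α β C : ℝ}
    (hα : 0 < α) (hα' : α < 1) (hβ : 0 < β) (hβ' : β ≤ 2) (hX : IsLevyProcess X P)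
    (htail : ∀ v, 0 < v → P.real {ω | v < ‖X 1 ω‖} ≤ C * v ^ (-β))
    (hτ : IsStableSubordinator α τ P)
    (hXτ : IndepFun (fun ω s => X s ω) (fun ω s => τ s ω) P) {a t : ℝ} (hat : a < t) :
    ∃ K, ∀ w, 0 < w → P.real {ω | w < ‖X (inverseTime τ a t ω) ω‖} ≤ K * w ^ (-β) := by
  obtain ⟨C', hC', hsup⟩ := hX.exists_measureReal_dyadic_sup_rpow_le hβ htail
  set ρ := mgf (τ 1) P (-1)
  have hρ : 0 ≤ ρ := mgf_nonneg
  have hρ' : ρ < 1 := hτ.mgf_neg_one_lt_one hα hα'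
  set F : ℕ → ℝ := fun n =>
    Real.exp (t - a) * ρ ^ (n - 1) * ((n + 1) * (n + 1 : ℝ) ^ β)
  have hF0 : ∀ n, 0 ≤ F n := fun n => by positivity
  have hF : Summable F := summable_geometric_mul_rpow _ hβ' hρ hρ'
  refine ⟨C' * ∑' n, F n, fun w hw => ?_⟩
  set G : ℕ → ℕ → Set Ω := fun n k => {ω | τ (n - 1 : ℕ) ω ≤ t - a} ∩
    {ω | (fun s => X s ω) ∈ largeIncrement k (w / (n + 1))}
  have hcover : {ω | w < ‖X (inverseTime τ a t ω) ω‖} ≤ᵐ[P]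
      ⋃ n, ⋃ k ∈ Finset.range (n + 1), G n k := by
    filter_upwards [hX.zero, hX.cadlag, hτ.isLevyProcess.zero] with ω h0 hc hτ0 hω
    set T := inverseTime τ a t ω with hT
    obtain ⟨m, j, hj, hlt⟩ := exists_dyadic_mem_of_continuousWithinAt (hc T).1
      (Nat.floor_le (zero_le : 0 ≤ T)) (Nat.lt_floor_add_one T)
      (U := {x | w < ‖x‖}) (isOpen_lt continuous_const continuous_norm) hω
    obtain ⟨k, hk, hinc⟩ := exists_dyadic_increment_gt (f := fun s => X s ω) h0 hj hlt
    refine Set.mem_iUnion.2 ⟨⌊T⌋₊, Set.mem_iUnion₂.2 ⟨k, hk, ?_, hinc⟩⟩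
    -- Stepping back by one makes the time strictly less than `T`. When the truncated difference is
    -- `0`, `τ 0 = 0` and `a < t` suffice.
    change τ ((⌊T⌋₊ - 1 : ℕ) : ℝ≥0) ω ≤ t - a
    rcases Nat.eq_zero_or_pos (⌊T⌋₊ - 1) with h | h
    · rw [h, Nat.cast_zero, hτ0]; linarith
    · refine le_of_lt_inverseTime (by exact_mod_cast h) ?_
      refine lt_of_lt_of_le ?_ (Nat.floor_le (zero_le : 0 ≤ T))
      exact_mod_cast (by omega : ⌊T⌋₊ - 1 < ⌊T⌋₊)
  have hG : ∀ n k, P.real (G n k)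
      ≤ Real.exp (t - a) * ρ ^ (n - 1) * (C' * (w / (n + 1)) ^ (-β)) := by
    intro n k
    have hA : MeasurableSet {g : ℝ≥0 → ℝ | g (n - 1 : ℕ) ≤ t - a} :=
      (measurable_pi_apply _) measurableSet_Iic
    have := hXτ.symm.measure_inter_preimage_eq_mul _ _ hA
      (measurableSet_largeIncrement (E := E) k (w / (n + 1)))
    have hprod : P.real (G n k) = P.real {ω | τ (n - 1 : ℕ) ω ≤ t - a} *
        P.real {ω | (fun s => X s ω) ∈ largeIncrement k (w / (n + 1))} := by
      have h := congrArg ENNReal.toReal this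
      rw [ENNReal.toReal_mul] at h
      exact h
    rw [hprod]
    exact mul_le_mul (hτ.measureReal_le _ _) (hsup _ (by positivity) k) measureReal_nonneg
      (by positivity)
  have hGsum : ∀ n, P (⋃ k ∈ Finset.range (n + 1), G n k)
      ≤ ENNReal.ofReal (C' * w ^ (-β) * F n) := by
    intro n
    refine ENNReal.le_ofReal_iff_toReal_le (measure_ne_top _ _)
      (mul_nonneg (by positivity) (hF0 n)) |>.2 ?_
    refine (measureReal_biUnion_finset_le _ _).trans
      ((Finset.sum_le_sum fun k _ => hG n k).trans_eq ?_)
    have hn : (0 : ℝ) < n + 1 := by positivity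
    rw [Finset.sum_const, Finset.card_range, nsmul_eq_mul, Real.div_rpow hw.le hn.le,
      Real.rpow_neg hn.le, div_inv_eq_mul]
    simp only [F]
    push_cast
    ring
  have hfin : P {ω | w < ‖X (inverseTime τ a t ω) ω‖}
      ≤ ENNReal.ofReal (C' * w ^ (-β) * ∑' n, F n) := by
    calc _ ≤ P (⋃ n, ⋃ k ∈ Finset.range (n + 1), G n k) := measure_mono_ae hcover
      _ ≤ ∑' n, P (⋃ k ∈ Finset.range (n + 1), G n k) := measure_iUnion_le _
      _ ≤ ∑' n, ENNReal.ofReal (C' * w ^ (-β) * F n) := ENNReal.tsum_le_tsum hGsum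
      _ = _ := by
        rw [← tsum_mul_left, ENNReal.ofReal_tsum_of_nonneg
          (fun n => mul_nonneg (by positivity) (hF0 n)) (hF.mul_left _)]
  have := ENNReal.toReal_le_of_le_ofReal
    (mul_nonneg (by positivity) (tsum_nonneg hF0)) hfin
  exact this.trans_eq (by ring)

end StableTimeChange

theorem proposition2p2 {Ω : Type*} [MeasurableSpace Ω] (P : Measure Ω) [IsProbabilityMeasure P]
    {d : ℕ} (α β : ℝ) (hα : 0 < α) (hα' : α < 1) (hβ : 0 < β) (hβ' : β ≤ 2)
    (X : ℝ≥0 → Ω → EuclideanSpace ℝ (Fin d)) (τ : ℝ≥0 → Ω → ℝ)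
    (hX : StableTimeChange.IsIsotropicStableProcess β X P)
    (hτ : StableTimeChange.IsStableSubordinator α τ P)
    (hXτ : IndepFun (fun ω s => X s ω) (fun ω s => τ s ω) P)
    (a t : ℝ) (hat : a < t) (x : EuclideanSpace ℝ (Fin d)) :
    (fun u : ℝ => P.real {ω | u < ‖x + X (StableTimeChange.inverseTime τ a t ω) ω‖})
      =O[atTop] (fun u : ℝ => u ^ (-β)) := by
  have hX1 := hX.isLevyProcess.measurable 1
  have : IsProbabilityMeasure (P.map (X 1)) :=
    Measure.isProbabilityMeasure_map hX1.aemeasurable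
  obtain ⟨C, hC⟩ := hX.isStableLaw.exists_measureReal_norm_gt_le hβ hβ'
  obtain ⟨K, hK⟩ := StableTimeChange.exists_measureReal_inverseTime_le hα hα' hβ hβ'
    hX.isLevyProcess (C := C) (fun v hv => by
      have := hC v hv
      rwa [map_measureReal_apply hX1 (measurableSet_lt measurable_const measurable_norm)] at this) hτ hXτ hat
  refine IsBigO.of_bound (K * 2 ^ β) ?_
  -- The starting point then accounts for at most half of `u`; halving costs the factor `2 ^ β`.
  filter_upwards [eventually_ge_atTop (2 * ‖x‖), eventually_gt_atTop 0] with u hu hu0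
  rw [Real.norm_of_nonneg measureReal_nonneg, Real.norm_of_nonneg (by positivity)]
  have hsub : {ω | u < ‖x + X (StableTimeChange.inverseTime τ a t ω) ω‖}
      ⊆ {ω | u / 2 < ‖X (StableTimeChange.inverseTime τ a t ω) ω‖} := fun ω hω => by
    have := norm_add_le x (X (StableTimeChange.inverseTime τ a t ω) ω)
    simp only [Set.mem_ofPred_eq] at hω ⊢
    linarith
  refine (measureReal_mono hsub).trans ((hK _ (half_pos hu0)).trans_eq ?_)
  rw [Real.div_rpow hu0.le zero_le_two, Real.rpow_neg zero_le_two, div_inv_eq_mul]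
  ring
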